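/- Let $D$ be a diagram of an oriented virtual link: a generic immersion of finitely many disjoint oriented circles into the plane (regular closed curves with finitely many transverse double points and no other singularities), in which each double point is declared to be either classical, with a choice of the over-strand, or virtual. The covering graph $\tilde D$ has the classical crossings as vertices and the long arcs as edges, i.e. the oriented arcs of the circles that run from one classical crossing to the next and may pass virtual crossings in between; a circle without classical crossings is a closed edge without vertices. Write $C^0(\tilde D,\mathbb Z)$ and $C^1(\tilde D,\mathbb Z)$ for the integral functions on the vertices and on the edges, and let $\delta f(e)=f(\text{end of }e)-f(\text{start of }e)$, and $\delta f(e)=0$ if $e$ is a closed edge. Draw each crossing so that both strands go upwards. The virtual index cocycle $vi_D\in C^1(\tilde D,\mathbb Z)$ assigns to an edge the sum of the signs of the virtual crossings that it passes, where a passage has sign $+1$ if it goes from the bottom left to the top right and $-1$ if it goes from the bottom right to the top left; so a virtual crossing that the edge passes twice contributes both signs. The virtual index class $\iota_D\in H^1(\tilde D,\mathbb Z)$ is the class of $vi_D$. For a classical crossing $c$ let $\beta^l(c)\in C^1(\tilde D,\mathbb Z)$ have the label $-1$ at the bottom left end and $+1$ at the top left end at $c$, and let $\beta^r(c)$ have the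 label $+1$ at the bottom right end and $-1$ at the top right end; the value on an edge is the sum of the labels at its ends at $c$, regardless of which strand goes over. Put $ci^l_D=\sum_c\beta^l(c)$ and $ci^r_D=\sum_c\beta^r(c)$, the sums being over all classical crossings. Theorem. For every such $D$ the two cochains coincide, $ci^l_D=ci^r_D=:ci_D$, and the canonical index cocycle $ci_D$ is cohomologous to $vi_D$: there is $f\in C^0(\tilde D,\mathbb Z)$ with $ci_D-vi_D=\delta f$. In other words, $ci_D$ represents the virtual index class, $[ci_D]=\iota_D$ in $H^1(\tilde D,\mathbb Z)$. -/

import Mathlib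

/-- A generic immersion of `n` disjoint oriented circles into the plane `ℂ`: regular closed
`C¹`-curves whose only singularities are finitely many transverse double points.  Each circle is
`ℝ/ℤ`, oriented by the positive direction of `ℝ`. -/
structure GenericImmersion where
  /-- the number of components -/
  n : ℕ
  /-- the immersed circles; `(i, x)` is the point `x` of the `i`-th circle -/
  pos : Fin n × UnitAddCircle → ℂ
  contDiff : ∀ i, ContDiff ℝ 1 (fun t : ℝ => pos (i, (t : UnitAddCircle)))
  immersion : ∀ i x, deriv (fun t : ℝ => pos (i, x + (t : UnitAddCircle))) 0 ≠ 0
  finite_double : {p | ∃ q, q ≠ p ∧ pos q = pos p}.Finite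
  no_triple : ∀ p q r, pos p = pos q → pos q = pos r → p = q ∨ q = r ∨ p = r
  transverse : ∀ i x j y, (i, x) ≠ (j, y) → pos (i, x) = pos (j, y) →
    LinearIndependent ℝ ![deriv (fun t : ℝ => pos (i, x + (t : UnitAddCircle))) 0,
      deriv (fun t : ℝ => pos (j, y + (t : UnitAddCircle))) 0]

namespace GenericImmersion

/-- The points of the parametrizing circles. -/
abbrev Point (D : GenericImmersion) : Type := Fin D.n × UnitAddCircle

/-- The velocity vector at a point of the parametrizing circles. -/
noncomputable def vel (D : GenericImmersion) (p : D.Point) : ℂ :=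
  deriv (fun t : ℝ => D.pos (p.1, p.2 + (t : UnitAddCircle))) 0

/-- The passages: those points that are mapped to double points.  There are two over each. -/
def passages (D : GenericImmersion) : Set D.Point := {p | ∃ q, q ≠ p ∧ D.pos q = D.pos p}

/-- The crossings: the double points in the plane. -/
def crossings (D : GenericImmersion) : Set ℂ := D.pos '' D.passages

theorem passages_finite (D : GenericImmersion) : D.passages.Finite := D.finite_double

theorem crossings_finite (D : GenericImmersion) : D.crossings.Finite :=
  D.passages_finite.image _

open Classical in
/-- The other passage through the same crossing (`p` itself if `p` is not a passage). -/
noncomputable def other (D : GenericImmersion) (p : D.Point) : D.Point :=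
  if h : ∃ q, q ≠ p ∧ D.pos q = D.pos p then h.choose else p

theorem other_eq (D : GenericImmersion) {p q : D.Point} (hne : q ≠ p)
    (hq : D.pos q = D.pos p) : D.other p = q := by
  have h : ∃ q, q ≠ p ∧ D.pos q = D.pos p := ⟨q, hne, hq⟩
  have hs := h.choose_spec
  rw [other, dif_pos h]
  rcases D.no_triple h.choose p q hs.2 hq.symm with h1 | h1 | h1
  · exact absurd h1 hs.1
  · exact absurd h1.symm hne
  · exact h1

/-- The sign of the strand at the passage `p`, that is, the local intersection number of the
strand through `p` with the other strand of the crossing.  If the crossing is drawn so that both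
strands go upwards, the sign is `1` for the strand that goes from the bottom left to the top right,
and `-1` for the strand that goes from the bottom right to the top left. -/
noncomputable def strandSign (D : GenericImmersion) (p : D.Point) : ℤ :=
  ((SignType.sign ((D.vel p).re * (D.vel (D.other p)).im
    - (D.vel p).im * (D.vel (D.other p)).re) : SignType) : ℤ)

end GenericImmersion

/-- A diagram of an oriented virtual link: a generic immersion of oriented circles into the plane,
a choice of the crossings that are classical, and at each of these a choice of the strand that
goes over.  The other crossings are virtual. -/
structure VirtualLinkDiagram extends GenericImmersion where
  /-- the classical crossings -/
  classical : Set ℂ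
  classical_subset : classical ⊆ toGenericImmersion.crossings
  /-- the passage through a classical crossing that goes over -/
  overPassage : classical → Fin n × UnitAddCircle
  pos_overPassage : ∀ c : classical, pos (overPassage c) = c

namespace VirtualLinkDiagram

/-- The points of the parametrizing circles. -/
abbrev Point (D : VirtualLinkDiagram) : Type := D.toGenericImmersion.Point

/-- The vertices of the covering graph: the classical crossings. -/
abbrev Vertex (D : VirtualLinkDiagram) : Type := D.classical

noncomputable instance (D : VirtualLinkDiagram) : Fintype D.Vertex :=
  (D.crossings_finite.subset D.classical_subset).fintype

/-- A long arc that runs from a classical crossing to a classical crossing and contains no classical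
crossing in between.  (Its two ends may be the same passage; then its length is `1`.) -/
structure LongArc (D : VirtualLinkDiagram) where
  /-- the component that contains the arc -/
  comp : Fin D.n
  /-- the parameter of the initial point -/
  start : UnitAddCircle
  /-- the length of the arc in the parametrizing circle `ℝ/ℤ` -/
  length : ℝ
  length_pos : 0 < length
  length_le : length ≤ 1
  start_mem : D.pos (comp, start) ∈ D.classical
  stop_mem : D.pos (comp, start + (length : UnitAddCircle)) ∈ D.classical
  interior_notMem : ∀ t : ℝ, 0 < t → t < length →
    D.pos (comp, start + (t : UnitAddCircle)) ∉ D.classical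

namespace LongArc

variable {D : VirtualLinkDiagram}

/-- The passage at which the long arc starts. -/
def initial (e : D.LongArc) : D.Point := (e.comp, e.start)

/-- The passage at which the long arc ends. -/
noncomputable def terminal (e : D.LongArc) : D.Point :=
  (e.comp, e.start + (e.length : UnitAddCircle))

/-- The vertex at which the long arc starts. -/
def source (e : D.LongArc) : D.Vertex := ⟨D.pos e.initial, e.start_mem⟩

/-- The vertex at which the long arc ends. -/
noncomputable def target (e : D.LongArc) : D.Vertex := ⟨D.pos e.terminal, e.stop_mem⟩

end LongArc

/-- The components without classical crossings; they are closed long arcs, and circles without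
vertices in the covering graph. -/
abbrev FreeCircle (D : VirtualLinkDiagram) : Type :=
  {i : Fin D.n // ∀ x : UnitAddCircle, D.pos (i, x) ∉ D.classical}

/-- The edges of the covering graph: the long arcs, including the closed ones. -/
abbrev Edge (D : VirtualLinkDiagram) : Type := D.LongArc ⊕ D.FreeCircle

/-- The interior points of an edge. -/
def edgeInterior (D : VirtualLinkDiagram) : D.Edge → Set D.Point
  | Sum.inl e => (fun t : ℝ => (e.comp, e.start + (t : UnitAddCircle))) '' Set.Ioo 0 e.length
  | Sum.inr i => {p | p.1 = i.1}

/-- The passages through virtual crossings. -/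
def virtualPassages (D : VirtualLinkDiagram) : Set D.Point :=
  {p | p ∈ D.passages ∧ D.pos p ∉ D.classical}

theorem virtualPassages_inter_finite (D : VirtualLinkDiagram) (e : D.Edge) :
    (D.virtualPassages ∩ D.edgeInterior e).Finite :=
  D.passages_finite.subset fun _ hp => hp.1.1

/-- Integral `0`-cochains of the covering graph. -/
abbrev Cochain0 (D : VirtualLinkDiagram) : Type := D.Vertex → ℤ

/-- Integral `1`-cochains of the covering graph; all of them are cocycles. -/
abbrev Cochain1 (D : VirtualLinkDiagram) : Type := D.Edge → ℤ

/-- The coboundary operator of the covering graph.  It vanishes on circles without vertices, as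
on any loop. -/
noncomputable def coboundary (D : VirtualLinkDiagram) : D.Cochain0 →+ D.Cochain1 where
  toFun f := Sum.elim (fun e => f e.target - f e.source) (fun _ => 0)
  map_zero' := by
    funext e
    cases e <;> simp
  map_add' f g := by
    funext e
    cases e
    · simp only [Sum.elim_inl, Pi.add_apply]
      ring
    · simp

/-- The first integral cohomology group of the covering graph. -/
abbrev H1 (D : VirtualLinkDiagram) : Type := D.Cochain1 ⧸ D.coboundary.range

/-- The cohomology class of a `1`-cochain. -/
noncomputable def cohomologyClass (D : VirtualLinkDiagram) (a : D.Cochain1) : D.H1 := QuotientAddGroup.mk a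

/-- Two `1`-cochains are cohomologous if they differ by the coboundary of a `0`-cochain. -/
def Cohomologous (D : VirtualLinkDiagram) (a b : D.Cochain1) : Prop :=
  ∃ f : D.Cochain0, a - b = D.coboundary f

/-- The virtual index cocycle: its value on a long arc is the sum of the signs of the virtual
crossings that the arc passes. -/
noncomputable def virtualIndexCocycle (D : VirtualLinkDiagram) : D.Cochain1 := fun e =>
  ∑ p ∈ (D.virtualPassages_inter_finite e).toFinset, D.strandSign p

/-- The virtual index class. -/
noncomputable def virtualIndexClass (D : VirtualLinkDiagram) : D.H1 :=
  D.cohomologyClass D.virtualIndexCocycle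

open Classical in
/-- The left cochain of a classical crossing `c`.  Draw `c` so that both strands go upwards: the
label is `-1` on the incoming edge on the left (the bottom left one, whose strand has sign `1`), `1`
on the outgoing edge on the left (the top left one, whose strand has sign `-1`), and `0` elsewhere.
The labels are added up on a loop that approaches `c` with both ends. -/
noncomputable def leftCochain (D : VirtualLinkDiagram) (c : D.Vertex) : D.Cochain1 :=
  Sum.elim
    (fun e => (if e.target = c ∧ D.strandSign e.terminal = 1 then -1 else 0)
      + (if e.source = c ∧ D.strandSign e.initial = -1 then 1 else 0))
    (fun _ => 0)

open Classical in
/-- The right cochain of a classical crossing `c`: the label is `1` on the incoming edge on the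
right (the bottom right one, whose strand has sign `-1`), `-1` on the outgoing edge on the right
(the top right one, whose strand has sign `1`), and `0` elsewhere. -/
noncomputable def rightCochain (D : VirtualLinkDiagram) (c : D.Vertex) : D.Cochain1 :=
  Sum.elim
    (fun e => (if e.target = c ∧ D.strandSign e.terminal = -1 then 1 else 0)
      + (if e.source = c ∧ D.strandSign e.initial = 1 then -1 else 0))
    (fun _ => 0)

/-- The left canonical index cocycle. -/
noncomputable def leftCanonicalCocycle (D : VirtualLinkDiagram) : D.Cochain1 :=
  ∑ c : D.Vertex, D.leftCochain c

/-- The right canonical index cocycle. -/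
noncomputable def rightCanonicalCocycle (D : VirtualLinkDiagram) : D.Cochain1 :=
  ∑ c : D.Vertex, D.rightCochain c

end VirtualLinkDiagram

open Complex Filter Topology Set

/-! From a point `z` of the plane, look at a moving point of a component and follow the axis (the
unoriented line) of the direction of sight through one period. With the angle doubled, the total
rotation is a multiple of 2π: off the curve it is 4π times the winding number. An axis, unlike a
direction, extends continuously through `z` on the curve, as the tangent line. So the rotation is
defined at all points, crossings included, and its sum over the components, `rotation`, is a
function on the plane.

Along a strand, `rotation` is locally constant away from crossings: the strand's own component is
seen continuously through the tangent. At a crossing the other strand contributes a jump of -2π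
times the strand sign on entering and the same jump on leaving
(`eventually_axisRotation_eq_of_crossing`, `eventually_rotation_eq`). Hence along an arc it changes
by -2π times the sum of the two end signs and twice the interior signs (`rotation_sub`). The
interior crossings of a long arc are virtual, and minus the sum of its end signs is twice the
canonical index. So the change is 4π times the canonical minus the virtual index, and `rotation /
(4π)`, rounded down, is the required 0-cochain. On a circle without classical crossings the change
around the circle is zero, so the virtual index vanishes there. -/

/-! ### Continuous arguments of paths in the unit circle. -/

theorem eq_of_continuousOn_of_int {f : ℝ → ℝ} {S : Set ℝ} (hS : IsPreconnected S)
    (hf : ContinuousOn f S) {d : ℝ} (hd : d ≠ 0) (hint : ∀ t ∈ S, ∃ n : ℤ, f t = n * d) {x y : ℝ}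
    (hx : x ∈ S) (hy : y ∈ S) : f x = f y := by
  have hT : DiscreteTopology (Set.range ((↑) : ℤ → ℝ)) :=
    (Int.isClosedEmbedding_coe_real.isEmbedding.toHomeomorph).symm.isEmbedding.discreteTopology
  have hg : ContinuousOn (fun t => f t / d) S := hf.div_const d
  have := hS.constant_of_mapsTo (T := Set.range ((↑) : ℤ → ℝ)) ⟨hT⟩ hg (fun t ht => by
    obtain ⟨n, hn⟩ := hint t ht
    exact ⟨n, by simp only [hn]; field_simp⟩) hx hy
  exact (div_left_inj' hd).1 this

theorem exists_int_of_exp_mul_I_eq {x y : ℝ} (h : exp (x * I) = exp (y * I)) :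
    ∃ n : ℤ, x - y = n * (2 * Real.pi) := by
  obtain ⟨n, hn⟩ := exp_eq_exp_iff_exists_int.1 h
  refine ⟨n, ?_⟩
  have := congrArg Complex.im hn
  simp at this
  linarith

theorem exists_argLift {u : ℝ → ℂ} (hu : Continuous u) (hu1 : ∀ t, ‖u t‖ = 1) :
    ∃ θ : ℝ → ℝ, Continuous θ ∧ ∀ t, u t = exp (θ t * I) := by
  have hs : IsSimplyConnected (univ : Set ℝ) := by
    have : ContractibleSpace (univ : Set ℝ) := convex_univ.contractibleSpace univ_nonempty
    exact SimplyConnectedSpace.ofContractible _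
  obtain ⟨f, hf, hfu⟩ := exists_continuousOn_eqOn_exp_comp hs isOpen_univ hu.continuousOn
    (by
      rintro ⟨t, -, ht⟩
      have := hu1 t
      rw [ht] at this
      simp at this)
  refine ⟨fun t => (f t).im, continuous_im.comp (continuousOn_univ.1 hf), fun t => ?_⟩
  have h := hfu (mem_univ t)
  simp only [Function.comp] at h
  have h1 := hu1 t
  rw [← h, norm_exp] at h1
  have h2 : (f t).re = 0 := by simpa using h1
  rw [← h]
  congr 1
  apply Complex.ext <;> simp [h2]

open Classical in
/-- A continuous choice of the argument of a path in the unit circle. -/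
noncomputable def argLift (u : ℝ → ℂ) : ℝ → ℝ :=
  if h : Continuous u ∧ ∀ t, ‖u t‖ = 1 then (exists_argLift h.1 h.2).choose else 0

theorem continuous_argLift {u : ℝ → ℂ} (hu : Continuous u) (hu1 : ∀ t, ‖u t‖ = 1) :
    Continuous (argLift u) := by
  rw [argLift, dif_pos ⟨hu, hu1⟩]
  exact (exists_argLift hu hu1).choose_spec.1

theorem exp_argLift {u : ℝ → ℂ} (hu : Continuous u) (hu1 : ∀ t, ‖u t‖ = 1) (t : ℝ) :
    exp (argLift u t * I) = u t := by
  rw [argLift, dif_pos ⟨hu, hu1⟩]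
  exact ((exists_argLift hu hu1).choose_spec.2 t).symm

/-- The difference of two lifts, one of them up to a constant factor, varies continuously within a
translate of 2πℤ, so it is constant. This allows increments to be computed with any convenient lift.
-/
theorem argLift_sub_argLift {u : ℝ → ℂ} (hu : Continuous u) (hu1 : ∀ t, ‖u t‖ = 1) {a b : ℝ}
    (hab : a ≤ b) {φ : ℝ → ℝ} (hφ : ContinuousOn φ (Icc a b)) (c : ℂ)
    (h : ∀ t ∈ Icc a b, u t = c * exp (φ t * I)) :
    argLift u b - argLift u a = φ b - φ a := by
  have key := eq_of_continuousOn_of_int (f := fun t => (argLift u t - φ t) - (argLift u a - φ a))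
    (S := Icc a b) isPreconnected_Icc
    (((continuous_argLift hu hu1).continuousOn.sub hφ).sub continuousOn_const)
    (d := 2 * Real.pi) (by positivity) (fun t ht => by
      apply exists_int_of_exp_mul_I_eq
      have aux : ∀ t ∈ Icc a b, exp ((argLift u t - φ t : ℝ) * I) = c := by
        intro t ht
        push_cast
        rw [sub_mul, Complex.exp_sub, exp_argLift hu hu1, h t ht]
        field_simp [Complex.exp_ne_zero]
      rw [aux t ht, aux a (left_mem_Icc.2 hab)])
    (left_mem_Icc.2 hab) (right_mem_Icc.2 hab)
  linarith

theorem argLift_add_period_sub {u : ℝ → ℂ} (hu : Continuous u) (hu1 : ∀ t, ‖u t‖ = 1)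
    (hper : ∀ t, u (t + 1) = u t) (x : ℝ) :
    argLift u (x + 1) - argLift u x = argLift u 1 - argLift u 0 := by
  have hc := continuous_argLift hu hu1
  have := eq_of_continuousOn_of_int (f := fun x => argLift u (x + 1) - argLift u x)
    (S := univ) isPreconnected_univ (by fun_prop) (d := 2 * Real.pi) (by positivity) (fun t _ => by
      apply exists_int_of_exp_mul_I_eq
      rw [exp_argLift hu hu1, exp_argLift hu hu1, hper]) (mem_univ x) (mem_univ 0)
  simpa using this

theorem exists_int_argLift_one_sub {u : ℝ → ℂ} (hu : Continuous u) (hu1 : ∀ t, ‖u t‖ = 1)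
    (hper : ∀ t, u (t + 1) = u t) :
    ∃ n : ℤ, argLift u 1 - argLift u 0 = n * (2 * Real.pi) := by
  apply exists_int_of_exp_mul_I_eq
  rw [exp_argLift hu hu1, exp_argLift hu hu1, ← hper 0, zero_add]

/-- The increment of the argument over a compact interval depends continuously on the path. -/
theorem tendsto_argLift_sub {U : ℝ → ℝ → ℂ} (hU : ∀ s, Continuous (U s))
    (hU1 : ∀ s t, ‖U s t‖ = 1) {s₀ a b : ℝ} (hab : a ≤ b)
    (hc : ∀ t ∈ Icc a b, ContinuousAt (fun p : ℝ × ℝ => U p.1 p.2) (s₀, t)) :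
    Tendsto (fun s => argLift (U s) b - argLift (U s) a) (𝓝 s₀)
      (𝓝 (argLift (U s₀) b - argLift (U s₀) a)) := by
  have hne : ∀ s t, U s t ≠ 0 := fun s t h => by simpa [h] using hU1 s t
  -- By compactness the quotient by the path at `s₀` is near 1 uniformly in `t`, so its principal
  -- argument corrects the lift at `s₀` to a lift at `s`.
  have h1 : ∀ᶠ s in 𝓝 s₀, ∀ t ∈ Icc a b, U s t / U s₀ t ∈ slitPlane := by
    apply isCompact_Icc.eventually_forall_of_forall_eventually
    intro t ht
    have : Tendsto (fun p : ℝ × ℝ => U p.1 p.2 / U s₀ p.2) (𝓝 (s₀, t)) (𝓝 (U s₀ t / U s₀ t)) :=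
      (hc t ht).div ((hU s₀).comp continuous_snd).continuousAt (hne _ _)
    rw [div_self (hne _ _)] at this
    exact this (isOpen_slitPlane.mem_nhds one_mem_slitPlane)
  have h2 : ∀ᶠ s in 𝓝 s₀, argLift (U s) b - argLift (U s) a =
      (argLift (U s₀) b + arg (U s b / U s₀ b)) - (argLift (U s₀) a + arg (U s a / U s₀ a)) := by
    filter_upwards [h1] with s hs
    refine argLift_sub_argLift (hU s) (hU1 s) hab
      (φ := fun t => argLift (U s₀) t + arg (U s t / U s₀ t)) ?_ 1 ?_
    · refine (continuous_argLift (hU s₀) (hU1 s₀)).continuousOn.add ?_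
      intro t ht
      exact (((continuousAt_arg (hs t ht)).comp (f := fun t => U s t / U s₀ t)
        ((hU s).continuousAt.div (hU s₀).continuousAt (hne _ _)))).continuousWithinAt
    · intro t ht
      push_cast
      have := norm_mul_exp_arg_mul_I (U s t / U s₀ t)
      rw [norm_div, hU1, hU1] at this
      simp only [div_one, ofReal_one, one_mul] at this
      rw [add_mul, Complex.exp_add, exp_argLift (hU s₀) (hU1 s₀), this, one_mul,
        mul_div_cancel₀ _ (hne _ _)]
  have h3 : ∀ t ∈ Icc a b, Tendsto (fun s => arg (U s t / U s₀ t)) (𝓝 s₀) (𝓝 0) := by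
    intro t ht
    have h4 : Tendsto (fun s => U s t / U s₀ t) (𝓝 s₀) (𝓝 (U s₀ t / U s₀ t)) :=
      Tendsto.div_const ((hc t ht).tendsto.comp (f := fun s : ℝ => (s, t))
        (by exact (by fun_prop : Continuous fun s : ℝ => (s, t)).tendsto s₀)) _
    rw [div_self (hne _ _)] at h4
    have := (continuousAt_arg one_mem_slitPlane).tendsto.comp h4
    simpa [Function.comp_def] using this
  refine Tendsto.congr' (h2.mono fun _ h => h.symm) ?_
  have := ((h3 b (right_mem_Icc.2 hab)).const_add (argLift (U s₀) b)).sub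
    ((h3 a (left_mem_Icc.2 hab)).const_add (argLift (U s₀) a))
  simpa using this

/-! ### Axes of sight and their total rotation. -/

/-- The square of the unit vector in direction `v`; it determines the real line spanned by `v`. -/
noncomputable def axis (v : ℂ) : ℂ := v / (starRingEnd ℂ) v

theorem norm_axis {v : ℂ} (hv : v ≠ 0) : ‖axis v‖ = 1 := by
  rw [axis, norm_div, RCLike.norm_conj, div_self (norm_ne_zero_iff.2 hv)]

theorem axis_mul (v w : ℂ) : axis (v * w) = axis v * axis w := by
  simp only [axis, map_mul, mul_div_mul_comm]

theorem axis_ofReal_mul {r : ℝ} (hr : r ≠ 0) (v : ℂ) : axis (r * v) = axis v := by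
  have : axis (r : ℂ) = 1 := by
    rw [axis, conj_ofReal, div_self (ofReal_ne_zero.2 hr)]
  rw [axis_mul, this, one_mul]

theorem axis_eq_exp {v : ℂ} (hv : v ≠ 0) : axis v = exp ((2 * arg v : ℝ) * I) := by
  have h1 : axis v = axis (exp (arg v * I)) := by
    conv_lhs => rw [← norm_mul_exp_arg_mul_I v]
    exact axis_ofReal_mul (norm_ne_zero_iff.2 hv) _
  rw [h1, axis, ← exp_conj, ← Complex.exp_sub]
  congr 1
  simp
  ring

theorem continuousAt_axis {v : ℂ} (hv : v ≠ 0) : ContinuousAt axis v :=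
  continuousAt_id.div continuous_conj.continuousAt (by simpa using hv)

open Classical in
/-- The axis of the direction in which the point `β t` of the curve `β` is seen from the point `z`.
If `β t = z`, the axis is that of the tangent. -/
noncomputable def axisFrom (β : ℝ → ℂ) (z : ℂ) (t : ℝ) : ℂ :=
  axis (if β t = z then deriv β t else β t - z)

theorem axisFrom_of_ne {β : ℝ → ℂ} {z : ℂ} {t : ℝ} (h : β t ≠ z) :
    axisFrom β z t = axis (β t - z) := by
  rw [axisFrom, if_neg h]

theorem norm_axisFrom {β : ℝ → ℂ} (hβ' : ∀ t, deriv β t ≠ 0) (z : ℂ) (t : ℝ) :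
    ‖axisFrom β z t‖ = 1 := by
  apply norm_axis
  split_ifs with h
  · exact hβ' t
  · exact sub_ne_zero.2 h

theorem axisFrom_add_one {β : ℝ → ℂ} (hper : ∀ t, β (t + 1) = β t) (z : ℂ) (t : ℝ) :
    axisFrom β z (t + 1) = axisFrom β z t := by
  have : deriv β (t + 1) = deriv β t := by
    rw [← deriv_comp_add_const]
    congr 1
    exact funext hper
  rw [axisFrom, axisFrom, hper, this]

theorem continuousAt_axisFrom_of_ne {β γ : ℝ → ℂ} {s t : ℝ} (hβ : ContinuousAt β t)
    (hγ : ContinuousAt γ s) (h : β t ≠ γ s) :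
    ContinuousAt (fun p : ℝ × ℝ => axisFrom β (γ p.1) p.2) (s, t) := by
  have h1 : ContinuousAt (fun p : ℝ × ℝ => β p.2 - γ p.1) (s, t) :=
    (hβ.comp (x := (s, t)) (f := Prod.snd) continuousAt_snd).sub
      (hγ.comp (x := (s, t)) (f := Prod.fst) continuousAt_fst)
  have h2 : ContinuousAt (fun p : ℝ × ℝ => axis (β p.2 - γ p.1)) (s, t) :=
    (continuousAt_axis (sub_ne_zero.2 h)).comp (x := (s, t))
      (f := fun p : ℝ × ℝ => β p.2 - γ p.1) h1
  refine h2.congr ?_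
  filter_upwards [h1.eventually_ne (sub_ne_zero.2 h)] with p hp
  rw [axisFrom_of_ne (sub_ne_zero.1 hp)]

/-- A chord divided by its parameter difference tends to the derivative jointly in both parameters,
by strict differentiability of a C¹ curve. The divisor is real, so it does not affect the axis even
when negative; the direction itself would flip here. -/
theorem continuousAt_axisFrom_self {β : ℝ → ℂ} (hβ : ContDiff ℝ 1 β) (s : ℝ)
    (hs : deriv β s ≠ 0) :
    ContinuousAt (fun p : ℝ × ℝ => axisFrom β (β p.1) p.2) (s, s) := by
  classical
  set F : ℝ × ℝ → ℂ := fun p => if β p.2 = β p.1 then deriv β p.2 else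
    ((p.2 - p.1 : ℝ) : ℂ)⁻¹ * (β p.2 - β p.1) with hF
  have hFa : (fun p : ℝ × ℝ => axisFrom β (β p.1) p.2) = axis ∘ F := by
    funext p
    simp only [Function.comp, hF]
    split_ifs with h
    · rw [axisFrom, if_pos h]
    · rw [axisFrom_of_ne h, ← ofReal_inv, axis_ofReal_mul]
      intro h0
      apply h
      rw [inv_eq_zero, sub_eq_zero] at h0
      rw [h0]
  have hFs : F (s, s) = deriv β s := by simp [hF]
  rw [hFa]
  refine ContinuousAt.comp (by rw [hFs]; exact continuousAt_axis hs) ?_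
  rw [ContinuousAt, hFs, Metric.tendsto_nhds]
  intro ε hε
  have h1 : ∀ᶠ p : ℝ × ℝ in 𝓝 (s, s),
      ‖β p.1 - β p.2 - (p.1 - p.2) • deriv β s‖ ≤ ε / 2 * ‖p.1 - p.2‖ :=
    (hβ.hasStrictDerivAt one_ne_zero).isLittleO.def (half_pos hε)
  have h2 : ∀ᶠ p : ℝ × ℝ in 𝓝 (s, s), dist (deriv β p.2) (deriv β s) < ε := by
    have : ContinuousAt (fun p : ℝ × ℝ => deriv β p.2) (s, s) :=
      ((hβ.continuous_deriv le_rfl).comp continuous_snd).continuousAt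
    exact Metric.tendsto_nhds.1 this ε hε
  filter_upwards [h1, h2] with p hp1 hp2
  simp only [hF]
  split_ifs with h
  · exact hp2
  · have hne : p.2 - p.1 ≠ 0 := fun h0 => h (by rw [sub_eq_zero.1 h0])
    have hne' : ((p.2 - p.1 : ℝ) : ℂ) ≠ 0 := ofReal_ne_zero.2 hne
    have e1 : ((p.2 - p.1 : ℝ) : ℂ)⁻¹ * (β p.2 - β p.1) - deriv β s =
        ((p.2 - p.1 : ℝ) : ℂ)⁻¹ * -(β p.1 - β p.2 - (p.1 - p.2) • deriv β s) := by
      rw [real_smul]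
      field_simp
      push_cast
      ring
    rw [dist_eq_norm, e1, norm_mul, norm_neg, norm_inv, norm_real, inv_mul_lt_iff₀ (by positivity)]
    have e2 : ‖p.2 - p.1‖ = ‖p.1 - p.2‖ := norm_sub_rev _ _
    have : 0 < ‖p.1 - p.2‖ := by rw [← e2]; positivity
    rw [e2]
    nlinarith

theorem continuous_axisFrom {β : ℝ → ℂ} (hβ : ContDiff ℝ 1 β) (hβ' : ∀ t, deriv β t ≠ 0) (z : ℂ) :
    Continuous (axisFrom β z) := by
  rw [continuous_iff_continuousAt]
  intro t
  by_cases h : β t = z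
  · subst h
    exact (continuousAt_axisFrom_self hβ t (hβ' t)).comp (f := fun x : ℝ => (t, x)) (x := t)
      (by fun_prop)
  · exact (continuousAt_axisFrom_of_ne (γ := fun _ => z) (s := 0) hβ.continuous.continuousAt
      continuousAt_const h).comp (f := fun x : ℝ => ((0 : ℝ), x)) (x := t) (by fun_prop)

/-- The total rotation of the axis in which a closed curve of period `1` is seen from `z`.  If `z`
is not on the curve, it is `4 * π` times the winding number; for a simple point of the curve, it is
`2 * π` times the sum of the winding numbers of the two adjacent regions. -/
noncomputable def axisRotation (β : ℝ → ℂ) (z : ℂ) : ℝ :=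
  argLift (axisFrom β z) 1 - argLift (axisFrom β z) 0

theorem exists_int_axisRotation {β : ℝ → ℂ} (hβ : ContDiff ℝ 1 β) (hβ' : ∀ t, deriv β t ≠ 0)
    (hper : ∀ t, β (t + 1) = β t) (z : ℂ) : ∃ n : ℤ, axisRotation β z = n * (2 * Real.pi) :=
  exists_int_argLift_one_sub (continuous_axisFrom hβ hβ' z) (norm_axisFrom hβ' z)
    (axisFrom_add_one hper z)

theorem argLift_add_one_sub_eq_axisRotation {β : ℝ → ℂ} (hβ : ContDiff ℝ 1 β)
    (hβ' : ∀ t, deriv β t ≠ 0) (hper : ∀ t, β (t + 1) = β t) (z : ℂ) (x : ℝ) :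
    argLift (axisFrom β z) (x + 1) - argLift (axisFrom β z) x = axisRotation β z :=
  argLift_add_period_sub (continuous_axisFrom hβ hβ' z) (norm_axisFrom hβ' z)
    (axisFrom_add_one hper z) x

/-- If the rotation is near a possible value, it is equal to it. -/
theorem axisRotation_eq_of_abs_lt {β : ℝ → ℂ} (hβ : ContDiff ℝ 1 β) (hβ' : ∀ t, deriv β t ≠ 0)
    (hper : ∀ t, β (t + 1) = β t) {z w : ℂ} (k : ℤ)
    (h : |axisRotation β z - axisRotation β w - k * (2 * Real.pi)| < 1) :
    axisRotation β z = axisRotation β w + k * (2 * Real.pi) := by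
  obtain ⟨n, hn⟩ := exists_int_axisRotation hβ hβ' hper z
  obtain ⟨m, hm⟩ := exists_int_axisRotation hβ hβ' hper w
  have e : axisRotation β z - axisRotation β w - k * (2 * Real.pi)
      = ((n - m - k : ℤ) : ℝ) * (2 * Real.pi) := by
    rw [hn, hm]; push_cast; ring
  rw [e, abs_mul, abs_of_pos Real.two_pi_pos] at h
  have h0 : n - m - k = 0 := by
    by_contra hne
    have : (1 : ℝ) ≤ |((n - m - k : ℤ) : ℝ)| := by exact_mod_cast Int.one_le_abs hne
    nlinarith [Real.pi_gt_three]
  rw [h0, Int.cast_zero, zero_mul] at e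
  linarith

/-- The rotation depends continuously on the viewpoint and takes values in 2πℤ. -/
theorem eventually_axisRotation_eq {β γ : ℝ → ℂ} (hβ : ContDiff ℝ 1 β) (hβ' : ∀ t, deriv β t ≠ 0)
    (hper : ∀ t, β (t + 1) = β t) {s₀ : ℝ}
    (hc : ∀ t, ContinuousAt (fun p : ℝ × ℝ => axisFrom β (γ p.1) p.2) (s₀, t)) :
    ∀ᶠ s in 𝓝 s₀, axisRotation β (γ s) = axisRotation β (γ s₀) := by
  have := tendsto_argLift_sub (U := fun s => axisFrom β (γ s)) (s₀ := s₀)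
    (fun s => continuous_axisFrom hβ hβ' _) (fun s t => norm_axisFrom hβ' _ t)
    zero_le_one (fun t _ => hc t)
  filter_upwards [Metric.tendsto_nhds.1 this 1 one_pos] with s hs
  have := axisRotation_eq_of_abs_lt hβ hβ' hper (z := γ s) (w := γ s₀) 0 (by
    rw [Int.cast_zero, zero_mul, sub_zero]
    exact hs)
  simpa using this

/-! ### The jump of the rotation at a transverse crossing. -/

/-- Since `ω` is not real, `σ - τω` can be real only for `τ = 0`, where it is positive. So it avoids
the cut by a margin proportional to `σ + |τ|`. -/
theorem mem_slitPlane_of_norm_sub_le {ω F : ℂ} (hω : ω.im ≠ 0) {σ τ : ℝ} (hσ : 0 < σ)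
    (h : ‖F - (σ - τ * ω)‖ ≤ |ω.im| / (8 * (‖ω‖ + 1)) * (σ + |τ|)) : F ∈ slitPlane := by
  by_contra hF
  rw [mem_slitPlane_iff, not_or, not_lt, not_not] at hF
  obtain ⟨hre, him⟩ := hF
  have h1 := (abs_re_le_norm _).trans h
  have h2 := (abs_im_le_norm _).trans h
  simp [him] at h1 h2
  set m := |ω.im| with hm
  set W := ‖ω‖
  have hmpos : 0 < m := abs_pos.2 hω
  have hmW : m ≤ W := abs_im_le_norm ω
  set η := m / (8 * (W + 1)) with hη
  have hη0 : 0 < η := by positivity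
  have hη1 : η * (W + 1) = m / 8 := by rw [hη]; field_simp [(by positivity : W + 1 ≠ 0)]
  have hT := abs_nonneg τ
  set T := |τ|
  have h3 : τ * ω.re ≤ T * W := by
    calc τ * ω.re ≤ |τ * ω.re| := le_abs_self _
      _ = T * |ω.re| := abs_mul _ _
      _ ≤ T * W := by gcongr; exact abs_re_le_norm ω
  have h4 := (abs_le.1 h1).1
  have hη2 : η ≤ 1 / 8 := by
    by_contra hcon
    push Not at hcon
    nlinarith
  have hη3 : η ≤ m / 8 := by nlinarith
  have h5 : T * (W + 1) * (7 * m) ≤ σ * m := by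
    have : T * m * 7 / 8 ≤ η * σ := by nlinarith
    have := mul_le_mul_of_nonneg_right this (by positivity : 0 ≤ W + 1)
    nlinarith
  -- A vanishing imaginary part forces `|τ|` to be small against `σ`; then `σ` dominates the real
  -- part, contrary to `F.re ≤ 0`.
  have h6 : T * (W + 1) * 7 ≤ σ := by
    refine le_of_mul_le_mul_right ?_ hmpos
    linarith
  nlinarith

/-- Dividing by `x > 0` does not change the argument, and `f x / x` tends to `f'`. -/
theorem tendsto_arg_sub_nhdsGT {f : ℝ → ℂ} {f' : ℂ} (hf : HasDerivAt f f' 0)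
    (h0 : f 0 = 0) (hf' : f' ∈ slitPlane) :
    Tendsto (fun x => arg (f x)) (𝓝[>] 0) (𝓝 (arg f')) ∧ ∀ᶠ x in 𝓝[>] 0, f x ∈ slitPlane := by
  have h1 := hf.tendsto_slope_zero_right
  simp only [zero_add, h0, sub_zero] at h1
  constructor
  · refine ((continuousAt_arg hf').tendsto.comp h1).congr' ?_
    filter_upwards [self_mem_nhdsWithin] with x hx
    simp only [Function.comp, real_smul]
    exact arg_real_mul _ (inv_pos.2 hx)
  · filter_upwards [h1 (isOpen_slitPlane.mem_nhds hf'), self_mem_nhdsWithin] with x hx hx0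
    have hx0' : 0 < x := hx0
    have hx1 : (x⁻¹ • f x) ∈ slitPlane := hx
    rw [mem_slitPlane_iff] at hx1 ⊢
    simp only [smul_re, smul_im, smul_eq_mul] at hx1
    refine hx1.imp (fun h => ?_) (fun h h' => h (by rw [h', mul_zero]))
    exact pos_of_mul_pos_right h (inv_pos.2 hx0').le

/-- To first order `(γ s - β t) / a` is `σ - τ(b / a)` with `σ = s - s₀` and `τ = t - t₀`. The range
of `t` does not shrink with `s`, so the principal argument follows the whole passage of `β` near the
crossing. -/
theorem eventually_forall_div_mem_slitPlane {β γ : ℝ → ℂ} {s₀ t₀ : ℝ} {a b : ℂ}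
    (hβ : HasDerivAt β b t₀) (hγ : HasDerivAt γ a s₀) (h : β t₀ = γ s₀) (him : (b / a).im ≠ 0) :
    ∃ ε > 0, ∀ᶠ s in 𝓝[>] s₀, ∀ t, |t - t₀| < ε → (γ s - β t) / a ∈ slitPlane := by
  have ha : a ≠ 0 := by
    rintro rfl
    simp at him
  set η := |(b / a).im| / (8 * (‖b / a‖ + 1)) with hη
  have hη0 : 0 < η := by
    have := abs_pos.2 him
    positivity
  have hβ1 := (hasDerivAt_iff_isLittleO.1 hβ).def (mul_pos hη0 (norm_pos_iff.2 ha))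
  have hγ1 := (hasDerivAt_iff_isLittleO.1 hγ).def (mul_pos hη0 (norm_pos_iff.2 ha))
  obtain ⟨ε, hε, hβ2⟩ := Metric.eventually_nhds_iff.1 hβ1
  refine ⟨ε, hε, ?_⟩
  filter_upwards [nhdsWithin_le_nhds hγ1, self_mem_nhdsWithin] with s hs hss t ht
  have hσ : 0 < s - s₀ := sub_pos.2 hss
  have ht1 := hβ2 (y := t) (by rwa [Real.dist_eq])
  refine mem_slitPlane_of_norm_sub_le him (σ := s - s₀) (τ := t - t₀) hσ ?_
  have e : (γ s - β t) / a - (((s - s₀ : ℝ) : ℂ) - ((t - t₀ : ℝ) : ℂ) * (b / a)) =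
      ((γ s - γ s₀ - (s - s₀) • a) - (β t - β t₀ - (t - t₀) • b)) / a := by
    rw [real_smul, real_smul, h]
    field_simp
    ring
  rw [e, norm_div, div_le_iff₀ (norm_pos_iff.2 ha)]
  refine (norm_sub_le _ _).trans ((add_le_add hs ht1).trans (le_of_eq ?_))
  rw [Real.norm_eq_abs, Real.norm_eq_abs, abs_of_pos hσ]
  ring

theorem argLift_axisFrom_sub {β : ℝ → ℂ} (hβ : ContDiff ℝ 1 β) (hβ' : ∀ t, deriv β t ≠ 0)
    {z a : ℂ} {x y : ℝ} (hxy : x ≤ y) (h : ∀ t ∈ Icc x y, (z - β t) / a ∈ slitPlane) :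
    argLift (axisFrom β z) y - argLift (axisFrom β z) x
      = 2 * arg ((z - β y) / a) - 2 * arg ((z - β x) / a) := by
  refine argLift_sub_argLift (continuous_axisFrom hβ hβ' z) (norm_axisFrom hβ' z) hxy
    (φ := fun t => 2 * arg ((z - β t) / a)) ?_ (axis (-a)) ?_
  · intro t ht
    have hc := hβ.continuous
    refine ContinuousAt.continuousWithinAt (ContinuousAt.mul continuousAt_const ?_)
    exact (continuousAt_arg (h t ht)).comp (f := fun t => (z - β t) / a) (by fun_prop)
  · intro t ht
    have h0 := slitPlane_ne_zero (h t ht)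
    have ha : a ≠ 0 := by
      rintro rfl
      simp at h0
    have hne : β t ≠ z := by
      rintro rfl
      simp at h0
    rw [axisFrom_of_ne hne, ← axis_eq_exp h0, ← axis_mul]
    congr 1
    field_simp
    ring

theorem two_mul_arg_neg_sub {ω : ℂ} (h : ω.im ≠ 0) :
    2 * arg (-ω) - 2 * arg ω = ((-(SignType.sign ω.im : ℤ) : ℤ) : ℝ) * (2 * Real.pi) := by
  rcases lt_or_gt_of_ne h with h1 | h1
  · rw [arg_neg_eq_arg_add_pi_of_im_neg h1, sign_neg h1]
    simp
    ring
  · rw [arg_neg_eq_arg_sub_pi_of_im_pos h1, sign_pos h1]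
    simp
    ring

/-- When `γ` leaves a transverse crossing with `β`, half of the intersection sign is subtracted from
twice the winding number. -/
theorem eventually_axisRotation_eq_of_crossing {β γ : ℝ → ℂ} (hβ : ContDiff ℝ 1 β)
    (hβ' : ∀ t, deriv β t ≠ 0) (hper : ∀ t, β (t + 1) = β t) {s₀ t₀ : ℝ} {a : ℂ}
    (hγ : HasDerivAt γ a s₀) (h : β t₀ = γ s₀) (him : (deriv β t₀ / a).im ≠ 0)
    (hc : ∀ t, (∀ n : ℤ, t ≠ t₀ + n) →
      ContinuousAt (fun p : ℝ × ℝ => axisFrom β (γ p.1) p.2) (s₀, t)) :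
    ∀ᶠ s in 𝓝[>] s₀, axisRotation β (γ s) = axisRotation β (γ s₀)
      + ((-(SignType.sign (deriv β t₀ / a).im : ℤ) : ℤ) : ℝ) * (2 * Real.pi) := by
  set b := deriv β t₀
  have hb : HasDerivAt β b t₀ := (hβ.differentiable one_ne_zero t₀).hasDerivAt
  set u := fun s => axisFrom β (γ s) with hu
  have huc : ∀ s, Continuous (u s) := fun s => continuous_axisFrom hβ hβ' _
  have hu1 : ∀ s t, ‖u s t‖ = 1 := fun s t => norm_axisFrom hβ' _ t
  obtain ⟨ε, hε, hslit⟩ := eventually_forall_div_mem_slitPlane hb hγ h him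
  have hfp : HasDerivAt (fun x => (γ s₀ - β (t₀ + x)) / a) (-(b / a)) 0 := by
    have h1 : HasDerivAt (fun x => β (t₀ + x)) b 0 := by
      apply HasDerivAt.comp_const_add
      simpa using hb
    have := (h1.const_sub (γ s₀)).div_const a
    rwa [neg_div] at this
  have hfm : HasDerivAt (fun x => (γ s₀ - β (t₀ - x)) / a) (b / a) 0 := by
    have h1 : HasDerivAt (fun x => β (t₀ - x)) (-b) 0 := by
      apply HasDerivAt.comp_const_sub
      simpa using hb
    have := (h1.const_sub (γ s₀)).div_const a
    rwa [neg_neg] at this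
  have hωs : b / a ∈ slitPlane := mem_slitPlane_iff.2 (Or.inr him)
  have hωs' : -(b / a) ∈ slitPlane := mem_slitPlane_iff.2 (Or.inr (by simpa using him))
  obtain ⟨hp1, hp2⟩ := tendsto_arg_sub_nhdsGT hfp (by simp [h]) hωs'
  obtain ⟨hm1, hm2⟩ := tendsto_arg_sub_nhdsGT hfm (by simp [h]) hωs
  have hLc := continuous_argLift (huc s₀) (hu1 s₀)
  have hL : Tendsto (fun x => argLift (u s₀) (t₀ + x) - argLift (u s₀) (t₀ - x)) (𝓝[>] 0) (𝓝 0) := by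
    have : Continuous (fun x => argLift (u s₀) (t₀ + x) - argLift (u s₀) (t₀ - x)) := by fun_prop
    have := this.tendsto 0
    simp only [add_zero, sub_zero, sub_self] at this
    exact this.mono_left nhdsWithin_le_nhds
  have hδ1 : ∀ᶠ x : ℝ in 𝓝[>] 0, x < min ε (1 / 2) :=
    nhdsWithin_le_nhds (Iio_mem_nhds (by positivity))
  -- The errors 2/10 + 2/10 + 1/10 from `δ`, together with the final 1/10 from `s`, stay below the
  -- bound 1 that separates multiples of 2π.
  obtain ⟨δ, hδp, hδm, hδps, hδms, hδL, hδε, hδ0⟩ :=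
    ((Metric.tendsto_nhds.1 hp1 (1 / 10) (by norm_num)).and
      ((Metric.tendsto_nhds.1 hm1 (1 / 10) (by norm_num)).and
      (hp2.and (hm2.and ((Metric.tendsto_nhds.1 hL (1 / 10) (by norm_num)).and
      (hδ1.and self_mem_nhdsWithin)))))).exists
  replace hδ0 : 0 < δ := hδ0
  have hδ2 : δ < ε := hδε.trans_le (min_le_left _ _)
  have hδ3 : δ < 1 / 2 := hδε.trans_le (min_le_right _ _)
  simp only [Real.dist_eq, sub_zero] at hδp hδm hδL
  -- the part of the period away from the crossing
  have hfar := tendsto_argLift_sub (U := u) (s₀ := s₀) (a := t₀ + δ) (b := t₀ - δ + 1) huc hu1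
    (by linarith) (fun t ht => hc t (fun n hn => by
      obtain ⟨ht1, ht2⟩ := ht
      have h1 : (0 : ℝ) < n := by linarith
      have h2 : (n : ℝ) < 1 := by linarith
      have h1' : 0 < n := by exact_mod_cast h1
      have h2' : n < 1 := by exact_mod_cast h2
      omega))
  have hγc := hγ.continuousAt
  have harg : ∀ t, (γ s₀ - β t) / a ∈ slitPlane →
      Tendsto (fun s => arg ((γ s - β t) / a)) (𝓝 s₀) (𝓝 (arg ((γ s₀ - β t) / a))) := by
    intro t ht
    exact ((continuousAt_arg ht).comp (f := fun s => (γ s - β t) / a) (by fun_prop)).tendsto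
  have e1 : ∀ᶠ s in 𝓝[>] s₀, axisRotation β (γ s) =
      (2 * arg ((γ s - β (t₀ + δ)) / a) - 2 * arg ((γ s - β (t₀ - δ)) / a))
      + (argLift (u s) (t₀ - δ + 1) - argLift (u s) (t₀ + δ)) := by
    filter_upwards [hslit] with s hs
    rw [← argLift_axisFrom_sub hβ hβ' (by linarith : t₀ - δ ≤ t₀ + δ) (fun t ht => hs t (by
      rw [abs_lt]
      constructor <;> linarith [ht.1, ht.2])),
      ← argLift_add_one_sub_eq_axisRotation hβ hβ' hper (γ s) (t₀ - δ)]
    simp only [hu]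
    ring
  -- In the limit the short interval contributes nearly `2 arg(-ω) - 2 arg ω`, a full turn, while at
  -- `s₀` itself the axis hardly turns there (`hδL`). The far part is continuous at `s₀`, so this
  -- turn is the jump.
  have e2 : Tendsto (fun s => axisRotation β (γ s)) (𝓝[>] s₀)
      (𝓝 ((2 * arg ((γ s₀ - β (t₀ + δ)) / a) - 2 * arg ((γ s₀ - β (t₀ - δ)) / a))
      + (argLift (u s₀) (t₀ - δ + 1) - argLift (u s₀) (t₀ + δ)))) := by
    refine Tendsto.congr' (e1.mono fun _ h => h.symm) (Tendsto.mono_left ?_ nhdsWithin_le_nhds)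
    exact (((harg _ hδps).const_mul 2).sub ((harg _ hδms).const_mul 2)).add hfar
  have e3 := argLift_add_one_sub_eq_axisRotation hβ hβ' hper (γ s₀) (t₀ - δ)
  have e4 := two_mul_arg_neg_sub him
  filter_upwards [Metric.tendsto_nhds.1 e2 (1 / 10) (by norm_num)] with s hs
  apply axisRotation_eq_of_abs_lt hβ hβ' hper
  rw [← e4, ← e3]
  rw [Real.dist_eq] at hs
  simp only [hu] at hs hδL
  rw [abs_lt] at hs hδp hδm hδL ⊢
  constructor <;> linarith

/-! ### Summation of jumps. -/

/-- A function on an interval that jumps by `-σ` both on entering and on leaving a point. -/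
theorem sub_eq_neg_sum_of_jumps {h σ : ℝ → ℝ} {a b : ℝ} (hab : a < b) {T : Finset ℝ}
    (hT : ∀ t ∈ T, t ∈ Ioo a b) (hσ : ∀ t ∈ Ioo a b, t ∉ T → σ t = 0)
    (hr : ∀ s, ∀ᶠ t in 𝓝[>] s, h t = h s - σ s) (hl : ∀ s, ∀ᶠ t in 𝓝[<] s, h t = h s + σ s) :
    h b - h a = -σ a - σ b - 2 * ∑ t ∈ T, σ t := by
  classical
  set F := insert a (insert b T) with hF
  have hσF : ∀ s ∈ Icc a b, s ∉ F → σ s = 0 := by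
    intro s hs hsF
    simp only [hF, Finset.mem_insert, not_or] at hsF
    exact hσ s ⟨lt_of_le_of_ne hs.1 (Ne.symm hsF.1), lt_of_le_of_ne hs.2 hsF.2.1⟩ hsF.2.2
  have hsign : ∀ s, ∀ᶠ t in 𝓝 s, ∀ r ∈ F, r ≠ s → Real.sign (t - r) = Real.sign (s - r) := by
    intro s
    rw [Filter.eventually_all_finset]
    intro r _
    by_cases hrs : r = s
    · simp [hrs]
    rcases lt_or_gt_of_ne hrs with h1 | h1
    · filter_upwards [Ioi_mem_nhds h1] with t ht _
      rw [Real.sign_of_pos (sub_pos.2 ht), Real.sign_of_pos (sub_pos.2 h1)]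
    · filter_upwards [Iio_mem_nhds h1] with t ht _
      rw [Real.sign_of_neg (sub_neg.2 ht), Real.sign_of_neg (sub_neg.2 h1)]
  -- The sign functions compensate all jumps; `Real.sign 0 = 0` gives the middle value at the jump
  -- itself. Thus `g` is locally constant on the closed interval.
  set g : ℝ → ℝ := fun s => h s + ∑ r ∈ F, Real.sign (s - r) * σ r with hg
  have hsum : ∀ s ∈ Icc a b, ∀ t, (∀ r ∈ F, r ≠ s → Real.sign (t - r) = Real.sign (s - r)) →
      ∑ r ∈ F, Real.sign (t - r) * σ r
        = ∑ r ∈ F, Real.sign (s - r) * σ r + Real.sign (t - s) * σ s := by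
    intro s hs t ht
    have h1 : ∑ r ∈ F, (if r = s then Real.sign (t - s) * σ s else 0)
        = Real.sign (t - s) * σ s := by
      rw [Finset.sum_ite_eq']
      split_ifs with h2
      · rfl
      · rw [hσF s hs h2, mul_zero]
    rw [← h1, ← Finset.sum_add_distrib]
    refine Finset.sum_congr rfl fun r hrF => ?_
    split_ifs with hrs
    · simp [hrs]
    · rw [ht r hrF hrs, add_zero]
  have hconst : ∀ s ∈ Icc a b, ∀ᶠ t in 𝓝 s, g t = g s := by
    intro s hs
    filter_upwards [hsign s, eventually_nhdsWithin_iff.1 (hr s),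
      eventually_nhdsWithin_iff.1 (hl s)] with t h1 h2 h3
    simp only [hg]
    rw [hsum s hs t h1]
    rcases lt_trichotomy t s with h4 | h4 | h4
    · rw [h3 h4, Real.sign_of_neg (sub_neg.2 h4)]
      ring
    · simp [h4]
    · rw [h2 h4, Real.sign_of_pos (sub_pos.2 h4)]
      ring
  have hgab : g b = g a := by
    refine constant_of_has_deriv_right_zero (fun s hs => ?_) (fun s hs => ?_) b
      (right_mem_Icc.2 hab.le)
    · exact (continuousAt_const.congr
        ((hconst s hs).mono fun _ h => h.symm)).continuousWithinAt
    · exact ((hasDerivAt_const s (g s)).congr_of_eventuallyEq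
        (hconst s (Ico_subset_Icc_self hs))).hasDerivWithinAt
  have haT : a ∉ insert b T := by
    rw [Finset.mem_insert, not_or]
    exact ⟨hab.ne, fun h => lt_irrefl _ (hT a h).1⟩
  have hbT : b ∉ T := fun h => lt_irrefl _ (hT b h).2
  simp only [hg, hF, Finset.sum_insert haT, Finset.sum_insert hbT, sub_self, Real.sign_zero,
    zero_mul, Real.sign_of_pos (sub_pos.2 hab), Real.sign_of_neg (sub_neg.2 hab)] at hgab
  have e1 : ∑ r ∈ T, Real.sign (b - r) * σ r = ∑ r ∈ T, σ r :=
    Finset.sum_congr rfl fun r hr' => by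
      rw [Real.sign_of_pos (sub_pos.2 (hT r hr').2), one_mul]
  have e2 : ∑ r ∈ T, Real.sign (a - r) * σ r = -∑ r ∈ T, σ r := by
    rw [← Finset.sum_neg_distrib]
    exact Finset.sum_congr rfl fun r hr' => by
      rw [Real.sign_of_neg (sub_neg.2 (hT r hr').1), neg_one_mul]
  rw [e1, e2] at hgab
  linarith

/-! ### The rotation function of an immersion along its strands. -/

namespace GenericImmersion

variable (D : GenericImmersion)

/-- The periodic parametrization of the `i`-th circle. -/
def curve (i : Fin D.n) (t : ℝ) : ℂ := D.pos (i, (t : UnitAddCircle))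

theorem curve_add_one (i : Fin D.n) (t : ℝ) : D.curve i (t + 1) = D.curve i t := by
  simp [curve]

theorem deriv_curve (i : Fin D.n) (t : ℝ) :
    deriv (D.curve i) t = D.vel (i, (t : UnitAddCircle)) := by
  have : (fun r : ℝ => D.pos (i, (t : UnitAddCircle) + (r : UnitAddCircle)))
      = fun r => D.curve i (t + r) := by
    funext r
    simp [curve]
  rw [vel, this, deriv_comp_const_add, add_zero]

theorem deriv_curve_ne_zero (i : Fin D.n) (t : ℝ) : deriv (D.curve i) t ≠ 0 := by
  rw [deriv_curve]
  exact D.immersion i t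

theorem contDiff_curve (i : Fin D.n) : ContDiff ℝ 1 (D.curve i) := D.contDiff i

theorem hasDerivAt_curve (i : Fin D.n) (t : ℝ) :
    HasDerivAt (D.curve i) (D.vel (i, (t : UnitAddCircle))) t := by
  rw [← deriv_curve]
  exact ((D.contDiff_curve i).differentiable one_ne_zero t).hasDerivAt

theorem other_of_notMem {p : D.Point} (hp : p ∉ D.passages) : D.other p = p := by
  exact dif_neg hp

/-- The default `other p = p` gives the cross product of a vector with itself. Hence the jump
formula holds at every point, not only at passages. -/
theorem strandSign_of_notMem {p : D.Point} (hp : p ∉ D.passages) : D.strandSign p = 0 := by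
  rw [strandSign, D.other_of_notMem hp, mul_comm, sub_self, sign_zero]
  rfl

theorem other_spec {p : D.Point} (hp : p ∈ D.passages) :
    D.other p ≠ p ∧ D.pos (D.other p) = D.pos p := by
  obtain ⟨q, hq⟩ := hp
  rw [D.other_eq hq.1 hq.2]
  exact hq

theorem cross_vel_ne_zero {p : D.Point} (hp : p ∈ D.passages) :
    (D.vel p).re * (D.vel (D.other p)).im - (D.vel p).im * (D.vel (D.other p)).re ≠ 0 := by
  obtain ⟨h1, h2⟩ := D.other_spec hp
  have hli : LinearIndependent ℝ ![D.vel p, D.vel (D.other p)] :=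
    D.transverse p.1 p.2 (D.other p).1 (D.other p).2 h1.symm h2.symm
  rw [LinearIndependent.pair_iff] at hli
  intro h0
  set a := D.vel p
  set b := D.vel (D.other p)
  -- If the determinant vanishes, `b.im • a - a.im • b` and `b.re • a - a.re • b` are both zero;
  -- independence then yields `a = 0`.
  have h3 := (hli b.im (-a.im) (by
    apply Complex.ext
    · simp
      linarith
    · simp
      ring)).2
  have h4 := (hli b.re (-a.re) (by
    apply Complex.ext
    · simp
      ring
    · simp
      linarith)).2
  have ha : a = 0 := Complex.ext (by simpa using h4) (by simpa using h3)
  exact one_ne_zero (hli 1 0 (by simp [ha])).1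

theorem strandSign_eq_one_or {p : D.Point} (hp : p ∈ D.passages) :
    D.strandSign p = 1 ∨ D.strandSign p = -1 := by
  rw [strandSign]
  rcases lt_or_gt_of_ne (D.cross_vel_ne_zero hp) with h | h
  · right
    rw [sign_neg h]
    rfl
  · left
    rw [sign_pos h]
    rfl

/-- On the same point of the circle the parameters differ by a period, which reduces to the tangent
case. Continuity is left open only at the second passage of a crossing. -/
theorem continuousAt_axisFrom_curve {i j : Fin D.n} {s t : ℝ}
    (h : ((j, (t : UnitAddCircle)) : D.Point) = (i, (s : UnitAddCircle)) ∨
      D.curve j t ≠ D.curve i s) :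
    ContinuousAt (fun p : ℝ × ℝ => axisFrom (D.curve j) (D.curve i p.1) p.2) (s, t) := by
  rcases h with h | h
  · obtain ⟨rfl, hts⟩ := Prod.mk.inj h
    have h1 : ((t - s : ℝ) : UnitAddCircle) = 0 := by
      rw [AddCircle.coe_sub, hts, sub_self]
    have h2 : ∀ r, D.curve j (r + (t - s)) = D.curve j r := by
      intro r
      rw [curve, AddCircle.coe_add, h1, add_zero, curve]
    have h3 := continuousAt_axisFrom_self (D.contDiff_curve j) t (D.deriv_curve_ne_zero j t)
    have h4 : ContinuousAt (fun p : ℝ × ℝ => (p.1 + (t - s), p.2)) (s, t) := by fun_prop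
    have h5 := ContinuousAt.comp (f := fun p : ℝ × ℝ => (p.1 + (t - s), p.2)) (x := (s, t))
      (g := fun p : ℝ × ℝ => axisFrom (D.curve j) (D.curve j p.1) p.2)
      (by simpa using h3) h4
    refine h5.congr (Eventually.of_forall fun p => ?_)
    simp only [Function.comp, h2]
  · exact continuousAt_axisFrom_of_ne (D.contDiff_curve j).continuous.continuousAt
      (D.contDiff_curve i).continuous.continuousAt h

/-- The sum over all components of the rotation of the axis in which they are seen from `z`. -/
noncomputable def rotation (z : ℂ) : ℝ := ∑ j, axisRotation (D.curve j) z

theorem sign_im_div_mul {a b : ℂ} {ε : ℝ} (hε : ε = 1 ∨ ε = -1) (ha : a ≠ 0) :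
    ((SignType.sign (b / (ε * a)).im : ℤ) : ℝ)
      = ε * ((SignType.sign (a.re * b.im - a.im * b.re) : SignType) : ℤ) := by
  have hn : 0 < normSq a := normSq_pos.2 ha
  have e : (b / (ε * a)).im = ε * ((a.re * b.im - a.im * b.re) / normSq a) := by
    rcases hε with rfl | rfl
    · simp [div_im]
      ring
    · simp [div_im, neg_div]
      ring
  have e2 : SignType.sign ((a.re * b.im - a.im * b.re) / normSq a)
      = SignType.sign (a.re * b.im - a.im * b.re) := by
    rw [div_eq_mul_inv, sign_mul, sign_pos (inv_pos.2 hn), mul_one]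
  rw [e, sign_mul, e2]
  rcases hε with rfl | rfl <;> simp

/-- Only the component of the other strand jumps, and only through that strand, even if it is the
same component. The factor `ε` selects leaving forwards or backwards; reversing the motion reverses
the intersection sign. -/
theorem eventually_rotation_eq (i : Fin D.n) (s : ℝ) {ε : ℝ} (hε : ε = 1 ∨ ε = -1) :
    ∀ᶠ r in 𝓝[>] (0 : ℝ), D.rotation (D.curve i (s + ε * r)) = D.rotation (D.curve i s)
      - ε * D.strandSign (i, (s : UnitAddCircle)) * (2 * Real.pi) := by
  classical
  set p : D.Point := (i, (s : UnitAddCircle)) with hp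
  set γ : ℝ → ℂ := fun r => D.curve i (s + ε * r) with hγ
  have hγ0 : γ 0 = D.curve i s := by simp [hγ]
  have hcont : ∀ (j : Fin D.n) (t : ℝ), (((j, (t : UnitAddCircle)) : D.Point) = p ∨ D.curve j t ≠ D.curve i s) →
      ContinuousAt (fun q : ℝ × ℝ => axisFrom (D.curve j) (γ q.1) q.2) (0, t) := by
    intro j t h
    have h4 : ContinuousAt (fun q : ℝ × ℝ => (s + ε * q.1, q.2)) (0, t) := by fun_prop
    exact ContinuousAt.comp (f := fun q : ℝ × ℝ => (s + ε * q.1, q.2)) (x := (0, t))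
      (g := fun q : ℝ × ℝ => axisFrom (D.curve j) (D.curve i q.1) q.2)
      (by simpa using D.continuousAt_axisFrom_curve h) h4
  have hconst : ∀ j, (∀ t : ℝ, D.curve j t = D.curve i s → ((j, (t : UnitAddCircle)) : D.Point) = p) →
      ∀ᶠ r in 𝓝[>] (0 : ℝ), axisRotation (D.curve j) (γ r)
        = axisRotation (D.curve j) (D.curve i s) := by
    intro j hj
    have := eventually_axisRotation_eq (β := D.curve j) (γ := γ) (s₀ := 0) (D.contDiff_curve j)
      (D.deriv_curve_ne_zero j) (D.curve_add_one j) (fun t => hcont j t (by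
        by_cases h : D.curve j t = D.curve i s
        · exact Or.inl (hj t h)
        · exact Or.inr h))
    rw [hγ0] at this
    exact nhdsWithin_le_nhds this
  by_cases hpass : p ∈ D.passages
  · obtain ⟨hne, hpos⟩ := D.other_spec hpass
    obtain ⟨t₀, ht₀⟩ := QuotientAddGroup.mk_surjective (D.other p).2
    have ho : D.other p = ((D.other p).1, (t₀ : UnitAddCircle)) := Prod.ext rfl ht₀.symm
    have honly : ∀ q, D.pos q = D.pos p → q ≠ D.other p → q = p := by
      intro q hq hqo
      by_contra hqp
      exact hqo (D.other_eq hqp hq).symm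
    have ha : D.vel p ≠ 0 := D.immersion i s
    have hder : HasDerivAt γ (ε * D.vel p) 0 := by
      have h1 : HasDerivAt (fun r : ℝ => s + ε * r) ε 0 := by
        simpa using ((hasDerivAt_id (0 : ℝ)).const_mul ε).const_add s
      have h2 : HasDerivAt (D.curve i) (D.vel p) (s + ε * 0) := by
        simpa using D.hasDerivAt_curve i s
      have h3 := h2.scomp (0 : ℝ) h1
      rw [real_smul] at h3
      exact h3
    have hvo : deriv (D.curve (D.other p).1) t₀ = D.vel (D.other p) := by
      rw [deriv_curve, ← ho]
    have hsign := sign_im_div_mul (b := D.vel (D.other p)) hε ha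
    have hcr : ∀ᶠ r in 𝓝[>] (0 : ℝ), axisRotation (D.curve (D.other p).1) (γ r)
        = axisRotation (D.curve (D.other p).1) (D.curve i s)
          - ε * D.strandSign p * (2 * Real.pi) := by
      have := eventually_axisRotation_eq_of_crossing (β := D.curve (D.other p).1) (γ := γ)
        (s₀ := 0) (t₀ := t₀) (D.contDiff_curve _)
        (D.deriv_curve_ne_zero _) (D.curve_add_one _) hder
        (by rw [hγ0, curve, ← ho, hpos, hp, curve])
        (by
          rw [hvo]
          intro h0
          rw [h0, sign_zero] at hsign
          rcases D.strandSign_eq_one_or hpass with h1 | h1 <;> rw [strandSign] at h1 <;>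
            rw [h1] at hsign <;> rcases hε with rfl | rfl <;> simp at hsign)
        (fun t ht => hcont _ t (by
          by_cases h : D.curve (D.other p).1 t = D.curve i s
          · refine Or.inl (honly _ h fun h' => ?_)
            rw [ho] at h'
            have h2 : (t : UnitAddCircle) = t₀ := (Prod.mk.inj h').2
            have h3 : ((t - t₀ : ℝ) : UnitAddCircle) = 0 := by simp [h2]
            obtain ⟨n, hn⟩ := (AddCircle.coe_eq_zero_iff (1 : ℝ)).1 h3
            apply ht n
            simp at hn
            linarith
          · exact Or.inr h))
      rw [hγ0, hvo] at this
      filter_upwards [this] with r hr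
      rw [hr, Int.cast_neg, hsign, strandSign]
      ring
    have hall : ∀ᶠ r in 𝓝[>] (0 : ℝ), ∀ j, axisRotation (D.curve j) (γ r)
        = axisRotation (D.curve j) (D.curve i s)
          - if j = (D.other p).1 then ε * D.strandSign p * (2 * Real.pi) else 0 := by
      rw [eventually_all]
      intro j
      by_cases hj : j = (D.other p).1
      · subst hj
        simpa using hcr
      · simpa [hj] using hconst j fun t ht => honly _ ht fun h => hj (congrArg Prod.fst h)
    filter_upwards [hall] with r hr
    simp only [rotation]
    rw [Finset.sum_congr rfl fun j _ => hr j, Finset.sum_sub_distrib, Finset.sum_ite_eq']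
    simp
  · have hall : ∀ᶠ r in 𝓝[>] (0 : ℝ), ∀ j, axisRotation (D.curve j) (γ r)
        = axisRotation (D.curve j) (D.curve i s) := by
      rw [eventually_all]
      intro j
      refine hconst j fun t ht => ?_
      by_contra h
      exact hpass ⟨_, h, ht⟩
    filter_upwards [hall] with r hr
    rw [D.strandSign_of_notMem hpass]
    simp only [rotation]
    rw [Finset.sum_congr rfl fun j _ => hr j]
    simp

/-- The rotation along an arc changes by the signs of the crossings that the arc passes; the
crossings at the ends count with half the weight. -/
theorem rotation_sub (i : Fin D.n) (x : UnitAddCircle) {L : ℝ} (hL : 0 < L) {T : Finset ℝ}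
    (hT : ∀ t : ℝ, t ∈ T ↔ t ∈ Ioo 0 L ∧ ((i, x + (t : UnitAddCircle)) : D.Point) ∈ D.passages) :
    D.rotation (D.pos (i, x + (L : UnitAddCircle))) - D.rotation (D.pos (i, x)) =
      (2 * Real.pi) * ((-D.strandSign (i, x) - D.strandSign (i, x + (L : UnitAddCircle))
        - 2 * ∑ t ∈ T, D.strandSign (i, x + (t : UnitAddCircle)) : ℤ) : ℝ) := by
  obtain ⟨x, rfl⟩ := QuotientAddGroup.mk_surjective x
  have hpi : (2 * Real.pi) ≠ 0 := by positivity
  have key := sub_eq_neg_sum_of_jumps (h := fun t => D.rotation (D.curve i (x + t)) / (2 * Real.pi))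
    (σ := fun t => (D.strandSign (i, ((x + t : ℝ) : UnitAddCircle)) : ℝ)) hL (T := T)
    (fun t ht => ((hT t).1 ht).1)
    (fun t ht ht' => by
      rw [Int.cast_eq_zero]
      exact D.strandSign_of_notMem fun h => ht' ((hT t).2 ⟨ht, by simpa using h⟩))
    (fun s => by
      have h := D.eventually_rotation_eq i (x + s) (Or.inl rfl)
      have h1 : Tendsto (fun t : ℝ => t - s) (𝓝[>] s) (𝓝[>] 0) := by
        refine tendsto_nhdsWithin_iff.2 ⟨?_, ?_⟩
        · have : Tendsto (fun t : ℝ => t - s) (𝓝 s) (𝓝 (s - s)) :=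
            (continuous_id.sub continuous_const).tendsto s
          rw [sub_self] at this
          exact this.mono_left nhdsWithin_le_nhds
        · filter_upwards [self_mem_nhdsWithin] with t ht
          exact mem_Ioi.2 (sub_pos.2 (mem_Ioi.1 ht))
      filter_upwards [h1.eventually h] with t ht
      have e : x + s + 1 * (t - s) = x + t := by ring
      rw [e] at ht
      rw [ht]
      field_simp)
    (fun s => by
      have h := D.eventually_rotation_eq i (x + s) (Or.inr rfl)
      have h1 : Tendsto (fun t : ℝ => s - t) (𝓝[<] s) (𝓝[>] 0) := by
        refine tendsto_nhdsWithin_iff.2 ⟨?_, ?_⟩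
        · have : Tendsto (fun t : ℝ => s - t) (𝓝 s) (𝓝 (s - s)) :=
            (continuous_const.sub continuous_id).tendsto s
          rw [sub_self] at this
          exact this.mono_left nhdsWithin_le_nhds
        · filter_upwards [self_mem_nhdsWithin] with t ht
          exact mem_Ioi.2 (sub_pos.2 (mem_Iio.1 ht))
      filter_upwards [h1.eventually h] with t ht
      have e : x + s + -1 * (s - t) = x + t := by ring
      rw [e] at ht
      rw [ht]
      field_simp
      ring)
  simp only [curve, AddCircle.coe_add, add_zero] at key
  push_cast
  rw [← sub_div, div_eq_iff hpi, mul_comm] at key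
  exact key

end GenericImmersion

/-! ### The cocycles on the edges of the covering graph. -/

theorem injOn_arc {n : ℕ} (i : Fin n) (x : UnitAddCircle) {L : ℝ} (hL : L ≤ 1) :
    InjOn (fun t : ℝ => ((i, x + (t : UnitAddCircle)) : Fin n × UnitAddCircle)) (Ico 0 L) := by
  have hmem : ∀ t ∈ Ico 0 L, t ∈ Ico (0 : ℝ) (0 + 1) := fun t ht =>
    ⟨ht.1, by linarith [ht.2]⟩
  intro s hs t ht h
  have h1 : (s : UnitAddCircle) = t := add_left_cancel (Prod.mk.inj h).2
  exact (AddCircle.coe_eq_coe_iff_of_mem_Ico (hmem s hs) (hmem t ht)).1 h1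

namespace GenericImmersion

theorem finite_arcPassages (D : GenericImmersion) (i : Fin D.n) (x : UnitAddCircle) {L : ℝ}
    (hL : L ≤ 1) :
    {t : ℝ | t ∈ Ioo 0 L ∧ ((i, x + (t : UnitAddCircle)) : D.Point) ∈ D.passages}.Finite := by
  refine Set.Finite.of_finite_image (D.passages_finite.subset ?_)
    ((injOn_arc i x hL).mono fun t ht => Ioo_subset_Ico_self ht.1)
  rintro _ ⟨t, ht, rfl⟩
  exact ht.2

end GenericImmersion

namespace VirtualLinkDiagram

variable (D : VirtualLinkDiagram)

theorem mem_passages_of_mem_classical {p : D.Point} (h : D.pos p ∈ D.classical) :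
    p ∈ D.passages := by
  obtain ⟨q, hq, hqp⟩ := D.classical_subset h
  by_cases hpq : q = p
  · rwa [← hpq]
  · exact ⟨q, hpq, hqp⟩

theorem virtualIndexCocycle_inl (e : D.LongArc) :
    D.virtualIndexCocycle (Sum.inl e) =
      ∑ t ∈ (D.finite_arcPassages e.comp e.start e.length_le).toFinset,
        D.strandSign (e.comp, e.start + (t : UnitAddCircle)) := by
  classical
  have hinj := (injOn_arc e.comp e.start e.length_le).mono
    (fun t ht => Ioo_subset_Ico_self ((Set.Finite.mem_toFinset _).1 ht).1 :
      ((D.finite_arcPassages e.comp e.start e.length_le).toFinset : Set ℝ) ⊆ _)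
  rw [← Finset.sum_image (f := D.strandSign) hinj, virtualIndexCocycle]
  congr 1
  ext p
  simp only [Set.Finite.mem_toFinset, Finset.mem_image, edgeInterior, virtualPassages,
    Set.mem_inter_iff, Set.mem_ofPred_eq, Set.mem_image]
  constructor
  · rintro ⟨⟨h1, -⟩, t, ht, rfl⟩
    exact ⟨t, ⟨ht, h1⟩, rfl⟩
  · rintro ⟨t, ⟨ht, h1⟩, rfl⟩
    exact ⟨⟨h1, e.interior_notMem t ht.1 ht.2⟩, t, ht, rfl⟩

/-- The circle is cut at the arbitrary point 0, which may be a passage and is therefore counted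
separately. -/
theorem virtualIndexCocycle_inr (i : D.FreeCircle) :
    D.virtualIndexCocycle (Sum.inr i) = D.strandSign (i.1, 0) +
      ∑ t ∈ (D.finite_arcPassages i.1 0 le_rfl).toFinset,
        D.strandSign (i.1, 0 + (t : UnitAddCircle)) := by
  classical
  set T := (D.finite_arcPassages i.1 0 le_rfl).toFinset with hTdef
  set g : ℝ → D.Point := fun t => (i.1, 0 + (t : UnitAddCircle)) with hg
  have hT : ∀ t ∈ T, t ∈ Ioo (0 : ℝ) 1 := fun t ht => ((Set.Finite.mem_toFinset _).1 ht).1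
  have h0T : (0 : ℝ) ∉ T := fun h => lt_irrefl _ (hT 0 h).1
  have hg0 : g 0 = (i.1, 0) := by simp [hg]
  have hinj : InjOn g (insert 0 T : Finset ℝ) := (injOn_arc i.1 0 le_rfl).mono (by
    intro t ht
    rw [Finset.coe_insert] at ht
    rcases ht with rfl | ht
    · simp
    · exact Ioo_subset_Ico_self (hT t ht))
  rw [← hg0, ← Finset.sum_insert (f := fun t => D.strandSign (g t)) h0T,
    ← Finset.sum_image (f := D.strandSign) hinj, virtualIndexCocycle]
  -- The index sets differ at most by the cut point, when it is no passage and so has sign 0.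
  apply Finset.sum_subset
  · rintro ⟨j, y⟩ hp
    simp only [Set.Finite.mem_toFinset, edgeInterior, virtualPassages,
      Set.mem_inter_iff, Set.mem_ofPred_eq] at hp
    obtain ⟨⟨h1, -⟩, rfl⟩ := hp
    obtain ⟨t, ht, rfl⟩ : ∃ t ∈ Ico (0 : ℝ) (0 + 1), (t : UnitAddCircle) = y := by
      have : y ∈ ((↑) : ℝ → UnitAddCircle) '' Ico (0 : ℝ) (0 + 1) := by
        rw [AddCircle.coe_image_Ico_eq]
        trivial
      exact this
    rw [zero_add] at ht
    refine Finset.mem_image.2 ⟨t, ?_, by simp [hg]⟩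
    rw [Finset.mem_insert]
    rcases ht.1.eq_or_lt with h | h
    · exact Or.inl h.symm
    · exact Or.inr ((Set.Finite.mem_toFinset _).2 ⟨⟨h, ht.2⟩, by simpa using h1⟩)
  · intro p hp hp'
    obtain ⟨t, -, rfl⟩ := Finset.mem_image.1 hp
    apply D.strandSign_of_notMem
    intro h
    exact hp' ((Set.Finite.mem_toFinset _).2 ⟨⟨h, i.2 _⟩, rfl⟩)

/-- For the full circle both ends are the cut point, so the rotation does not change and the two
half-weighted end terms add up to one whole passage. -/
theorem virtualIndexCocycle_freeCircle (i : D.FreeCircle) :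
    D.virtualIndexCocycle (Sum.inr i) = 0 := by
  have h := D.rotation_sub i.1 0 one_pos (T := (D.finite_arcPassages i.1 0 le_rfl).toFinset)
    (fun t => Set.Finite.mem_toFinset _)
  have h1 : ((1 : ℝ) : UnitAddCircle) = 0 := AddCircle.coe_period 1
  rw [h1, add_zero, sub_self, eq_comm, mul_eq_zero_iff_left (by positivity), Int.cast_eq_zero] at h
  rw [virtualIndexCocycle_inr]
  omega

open Classical in
theorem leftCanonicalCocycle_inl (e : D.LongArc) :
    D.leftCanonicalCocycle (Sum.inl e) = (if D.strandSign e.terminal = 1 then -1 else 0)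
      + (if D.strandSign e.initial = -1 then 1 else 0) := by
  simp only [leftCanonicalCocycle, leftCochain, Finset.sum_apply, Sum.elim_inl,
    Finset.sum_add_distrib, ite_and, Finset.sum_ite_eq, Finset.mem_univ, if_true]

open Classical in
theorem rightCanonicalCocycle_inl (e : D.LongArc) :
    D.rightCanonicalCocycle (Sum.inl e) = (if D.strandSign e.terminal = -1 then 1 else 0)
      + (if D.strandSign e.initial = 1 then -1 else 0) := by
  simp only [rightCanonicalCocycle, rightCochain, Finset.sum_apply, Sum.elim_inl,
    Finset.sum_add_distrib, ite_and, Finset.sum_ite_eq, Finset.mem_univ, if_true]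

theorem leftCanonicalCocycle_inr (i : D.FreeCircle) :
    D.leftCanonicalCocycle (Sum.inr i) = 0 := by
  simp [leftCanonicalCocycle, leftCochain]

theorem rightCanonicalCocycle_inr (i : D.FreeCircle) :
    D.rightCanonicalCocycle (Sum.inr i) = 0 := by
  simp [rightCanonicalCocycle, rightCochain]

theorem strandSign_initial (e : D.LongArc) :
    D.strandSign e.initial = 1 ∨ D.strandSign e.initial = -1 :=
  D.strandSign_eq_one_or (D.mem_passages_of_mem_classical e.start_mem)

theorem strandSign_terminal (e : D.LongArc) :
    D.strandSign e.terminal = 1 ∨ D.strandSign e.terminal = -1 :=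
  D.strandSign_eq_one_or (D.mem_passages_of_mem_classical e.stop_mem)

/-- For a terminal sign `s` and an initial sign `r`, the left value is `-(1+s)/2 + (1-r)/2` and the
right value is `(1-s)/2 - (1+r)/2`; both equal `-(r+s)/2`. -/
theorem leftCanonicalCocycle_eq_rightCanonicalCocycle :
    D.leftCanonicalCocycle = D.rightCanonicalCocycle := by
  funext e
  rcases e with e | i
  · rw [leftCanonicalCocycle_inl, rightCanonicalCocycle_inl]
    rcases D.strandSign_initial e with h1 | h1 <;> rcases D.strandSign_terminal e with h2 | h2 <;>
      simp [h1, h2]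
  · rw [leftCanonicalCocycle_inr, rightCanonicalCocycle_inr]

theorem two_mul_leftCanonicalCocycle_inl (e : D.LongArc) :
    2 * D.leftCanonicalCocycle (Sum.inl e)
      = -D.strandSign e.initial - D.strandSign e.terminal := by
  rw [leftCanonicalCocycle_inl]
  rcases D.strandSign_initial e with h1 | h1 <;> rcases D.strandSign_terminal e with h2 | h2 <;>
    simp [h1, h2]

theorem rotation_target_sub_rotation_source (e : D.LongArc) :
    D.rotation e.target - D.rotation e.source = (4 * Real.pi) *
      ((D.leftCanonicalCocycle (Sum.inl e) - D.virtualIndexCocycle (Sum.inl e) : ℤ) : ℝ) := by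
  have h := D.rotation_sub e.comp e.start e.length_pos
    (T := (D.finite_arcPassages e.comp e.start e.length_le).toFinset)
    (fun t => Set.Finite.mem_toFinset _)
  have h2 := D.two_mul_leftCanonicalCocycle_inl e
  simp only [LongArc.initial, LongArc.terminal] at h2
  rw [← virtualIndexCocycle_inl, ← h2] at h
  refine h.trans ?_
  push_cast
  ring

theorem cohomologous_leftCanonicalCocycle_virtualIndexCocycle :
    D.Cohomologous D.leftCanonicalCocycle D.virtualIndexCocycle := by
  -- At a vertex `rotation / (4π)` is only known to be a half-integer. Its increments along long
  -- arcs are integers, and rounding down preserves these.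
  refine ⟨fun c => ⌊D.rotation c / (4 * Real.pi)⌋, ?_⟩
  funext e
  rcases e with e | i
  · have h := D.rotation_target_sub_rotation_source e
    have h1 : D.rotation e.target / (4 * Real.pi) = D.rotation e.source / (4 * Real.pi)
        + ((D.leftCanonicalCocycle (Sum.inl e) - D.virtualIndexCocycle (Sum.inl e) : ℤ) : ℝ) := by
      rw [eq_add_of_sub_eq h]
      field_simp
      ring
    change D.leftCanonicalCocycle (Sum.inl e) - D.virtualIndexCocycle (Sum.inl e)
      = ⌊D.rotation e.target / (4 * Real.pi)⌋ - ⌊D.rotation e.source / (4 * Real.pi)⌋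
    rw [h1, Int.floor_add_intCast]
    ring
  · change D.leftCanonicalCocycle (Sum.inr i) - D.virtualIndexCocycle (Sum.inr i) = 0
    rw [leftCanonicalCocycle_inr, virtualIndexCocycle_freeCircle, sub_zero]

end VirtualLinkDiagram

/-- The canonical index cocycle (the common value of the left and the right one) is cohomologous to
the virtual index cocycle, that is, it represents the virtual index class. -/
theorem theorem1 (D : VirtualLinkDiagram) :
    D.leftCanonicalCocycle = D.rightCanonicalCocycle ∧
      D.Cohomologous D.leftCanonicalCocycle D.virtualIndexCocycle ∧
      D.cohomologyClass D.leftCanonicalCocycle = D.virtualIndexClass := by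
  refine ⟨D.leftCanonicalCocycle_eq_rightCanonicalCocycle,
    D.cohomologous_leftCanonicalCocycle_virtualIndexCocycle, ?_⟩
  obtain ⟨f, hf⟩ := D.cohomologous_leftCanonicalCocycle_virtualIndexCocycle
  refine (QuotientAddGroup.eq_iff_sub_mem).2 ⟨f, hf.symm⟩
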